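/- Let $(E_n)_{n\ge 0}$ be the Euler numbers, i.e. the integers determined by $E_0=1$, $E_{2n-1}=0$ and $\sum_{r=0}^{n}\binom{2n}{2r}E_{2r}=0$ for all $n\ge 1$. Let $b\ge 0$ be an even integer and let $k,m$ be positive integers. Then $$E_{2^mk+b}-E_b\equiv\begin{cases} 2k\bigl(-(b-7)^2+38+2k(3b-1+2k)\bigr) \pmod{2^{m+7}} & \text{if } m=1 \text{ and } 2\mid k,\\ 2k\bigl(-(b+1)^2+6+2k(3b-1+2k)\bigr)-16\bigl(b+(-1)^{b/2}\bigr) \pmod{2^{m+7}} & \text{if } m=1 \text{ and } 2\nmid k,\\ 4k\bigl(7(b+1)^2-18+12k\bigl(b+1+4((-1)^{b/2}-k)\bigr)\bigr) \pmod{2^{m+7}} & \text{if } m=2,\\ 2^mk\bigl(7(b+1)^2-18+2^mk(7-b)\bigr) \pmod{2^{m+7}} & \text{if } m\ge 3. \end{cases}$$ -/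

import Mathlib

/-- The Euler numbers `E₀, E₁, E₂, …`, as integers: `E₀ = 1`, `E_n = 0` for odd `n`, and for even
`n ≥ 2` the value `E_n` is the one determined by `∑_{r=0}^{n/2} C(n, 2r) E_{2r} = 0`. -/
def eulerNumber (n : ℕ) : ℤ :=
  if n = 0 then 1
  else if n % 2 = 1 then 0
  else -∑ r : Fin (n / 2), (n.choose (2 * r.val) : ℤ) * eulerNumber (2 * r.val)
termination_by n
decreasing_by
  have := r.isLt
  omega

/-- The initial value `E₀ = 1`. -/
theorem eulerNumber_zero : eulerNumber 0 = 1 := by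
  rw [eulerNumber]; simp

/-- The Euler numbers with odd index vanish. -/
theorem eulerNumber_odd (n : ℕ) (hn : 1 ≤ n) : eulerNumber (2 * n - 1) = 0 := by
  rw [eulerNumber, if_neg (by omega), if_pos (by omega)]

/-- The recurrence that determines the Euler numbers with even index. -/
theorem sum_choose_mul_eulerNumber (n : ℕ) (hn : 1 ≤ n) :
    ∑ r ∈ Finset.range (n + 1), ((2 * n).choose (2 * r) : ℤ) * eulerNumber (2 * r) = 0 := by
  have h : eulerNumber (2 * n) =
      -∑ r ∈ Finset.range n, ((2 * n).choose (2 * r) : ℤ) * eulerNumber (2 * r) := by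
    rw [eulerNumber, if_neg (by omega), if_neg (by omega), Nat.mul_div_cancel_left n (by omega)]
    rw [Finset.sum_range]
  rw [Finset.sum_range_succ, h]
  simp

/-! Let `L` be the functional `X ^ n ↦ E_n`. Newton interpolation gives `E_{2n} = ∑ C(n, r) D_r`
with `D_r = L((X² - 1)^r)`. The Euler recurrence determines `L` on products of `X² - (2j+1)²` as
signed factorials `(2i)!`, and re-expanding `(X² - 1)^r` in these products gives `2^(r+4) ∣ D_r` for
`r ≥ 6`. If `2^e ∣ N`, the terms with `r ≥ 6` therefore drop out of `E_{2n+2N} - E_{2n}` modulo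
`2^(e+8)`, leaving an explicit quintic. Taking `e = m - 1` settles `m ≥ 3`. The case `e = 2` gives
`E_{2n}` modulo `2^10` by the class of `n` mod 4, which suffices for `m = 1, 2`. -/

/-! ### The umbral functional -/

open Polynomial in
/-- The `ℤ`-linear functional on `ℤ[X]` sending `X ^ n` to the Euler number `E_n`. -/
noncomputable def eulerFunctional : ℤ[X] →ₗ[ℤ] ℤ :=
  Polynomial.lsum fun n => LinearMap.lsmul ℤ ℤ (eulerNumber n)

open Polynomial in
theorem eulerFunctional_X_pow (n : ℕ) : eulerFunctional (X ^ n) = eulerNumber n := by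
  rw [eulerFunctional, Polynomial.lsum_apply, X_pow_eq_monomial, sum_monomial_index] <;> simp

open Polynomial in
theorem eulerFunctional_C_mul (a : ℤ) (p : ℤ[X]) :
    eulerFunctional (C a * p) = a * eulerFunctional p := by
  rw [← smul_eq_C_mul, map_smul, smul_eq_mul]

theorem add_one_pow_add_sub_one_pow {R : Type*} [CommRing R] (x : R) (n : ℕ) :
    (x + 1) ^ (2 * n) + (x - 1) ^ (2 * n) =
      2 * ∑ r ∈ Finset.range (n + 1), ((2 * n).choose (2 * r) : R) * x ^ (2 * r) := by
  have key : ∀ m : ℕ, ∀ f : ℕ → R, ∑ i ∈ Finset.range (2 * m + 1), f i =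
      ∑ r ∈ Finset.range (m + 1), f (2 * r) + ∑ r ∈ Finset.range m, f (2 * r + 1) := by
    intro m f
    induction m with
    | zero => simp
    | succ m ih =>
      rw [show 2 * (m + 1) + 1 = 2 * m + 1 + 1 + 1 by ring, Finset.sum_range_succ,
        Finset.sum_range_succ, ih, Finset.sum_range_succ _ (m + 1), Finset.sum_range_succ _ m,
        Finset.sum_range_succ (fun r => f (2 * r + 1)), show 2 * m + 1 + 1 = 2 * (m + 1) by ring]
      ring
  have ho : ∀ r : ℕ, (-x) ^ (2 * r + 1) = - x ^ (2 * r + 1) := fun r =>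
    Odd.neg_pow (odd_two_mul_add_one r) x
  have he : ∀ r : ℕ, (-x) ^ (2 * r) = x ^ (2 * r) := fun r => Even.neg_pow (even_two_mul r) x
  rw [← Even.neg_pow (even_two_mul n) (x - 1), neg_sub', sub_neg_eq_add, add_pow, add_pow, key,
    key]
  simp only [one_pow, mul_one, ho, he, neg_mul, Finset.sum_neg_distrib, mul_comm (x ^ _)]
  ring_nf

-- Umbral form of the recurrence: on monomials it says `(E+1)^(2n) + (E-1)^(2n) = 0` for `n ≥ 1`.
open Polynomial in
theorem eulerFunctional_even_shift (g : ℤ[X]) :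
    eulerFunctional (g.comp ((X + 1) ^ 2) + g.comp ((X - 1) ^ 2)) = 2 * g.eval 0 := by
  induction g using Polynomial.induction_on' with
  | add p q hp hq =>
    rw [map_add] at hp hq ⊢
    rw [add_comp, add_comp, map_add, map_add, eval_add]
    linarith
  | monomial n a =>
    rw [monomial_comp, monomial_comp, ← mul_add, eulerFunctional_C_mul, ← pow_mul, ← pow_mul,
      add_one_pow_add_sub_one_pow, eval_monomial]
    have h2 : ∀ p : ℤ[X], eulerFunctional (2 * p) = 2 * eulerFunctional p := fun p => by
      simpa using eulerFunctional_C_mul 2 p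
    have h : ∀ r : ℕ, eulerFunctional (((2 * n).choose (2 * r) : ℤ[X]) * X ^ (2 * r)) =
        ((2 * n).choose (2 * r) : ℤ) * eulerNumber (2 * r) := fun r => by
      rw [← eulerFunctional_X_pow, ← eulerFunctional_C_mul]
      simp
    rw [h2, map_sum, Finset.sum_congr rfl fun r _ => h r]
    rcases Nat.eq_zero_or_pos n with rfl | hn
    · simp [eulerNumber_zero, mul_comm]
    · rw [sum_choose_mul_eulerNumber n hn, zero_pow hn.ne']
      ring

/-! ### Values on products of odd factors -/

open Polynomial in
/-- The product `∏_{j < i} (X² - (2j+1)²)`. -/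
noncomputable def oddProduct (i : ℕ) : ℤ[X] :=
  ∏ j ∈ Finset.range i, (X ^ 2 - C ((2 * (j : ℤ) + 1) ^ 2))

open Polynomial in
theorem oddProduct_succ (i : ℕ) :
    oddProduct (i + 1) = oddProduct i * (X ^ 2 - C ((2 * (i : ℤ) + 1) ^ 2)) :=
  Finset.prod_range_succ _ _

-- Each factor splits as `(X - (2j+1)) * (X + (2j+3))`, so the linear factors regroup with a shift.
open Polynomial in
theorem add_one_mul_prod_eq (i : ℕ) :
    (X + 1) * ∏ j ∈ Finset.range i, ((X + 1) ^ 2 - C ((2 * ((j : ℤ) + 1)) ^ 2)) =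
      oddProduct i * (X + C (2 * (i : ℤ) + 1)) := by
  induction i with
  | zero => simp [oddProduct]
  | succ i ih =>
    rw [Finset.prod_range_succ, ← mul_assoc, ih, oddProduct_succ]
    simp only [map_pow, map_mul, map_add, map_one, map_ofNat, Nat.cast_succ]
    ring

open Polynomial in
theorem sub_one_mul_prod_eq (i : ℕ) :
    (X - 1) * ∏ j ∈ Finset.range i, ((X - 1) ^ 2 - C ((2 * ((j : ℤ) + 1)) ^ 2)) =
      oddProduct i * (X - C (2 * (i : ℤ) + 1)) := by
  induction i with
  | zero => simp [oddProduct]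
  | succ i ih =>
    rw [Finset.prod_range_succ, ← mul_assoc, ih, oddProduct_succ]
    simp only [map_pow, map_mul, map_add, map_one, map_ofNat, Nat.cast_succ]
    ring

open Polynomial in
theorem eulerFunctional_oddProduct_succ (i : ℕ) :
    eulerFunctional (oddProduct (i + 1)) =
      -((2 * (i : ℤ) + 1) * (2 * i + 2)) * eulerFunctional (oddProduct i) := by
  -- The leading factor `X` makes the right-hand side vanish.
  have h := eulerFunctional_even_shift
    (X * ∏ j ∈ Finset.range i, (X - C ((2 * ((j : ℤ) + 1)) ^ 2)))
  simp only [mul_comp, prod_comp, sub_comp, X_comp, C_comp, eval_mul, eval_X, zero_mul,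
    mul_zero] at h
  have e : (X + 1) ^ 2 * ∏ j ∈ Finset.range i, ((X + 1) ^ 2 - C ((2 * ((j : ℤ) + 1)) ^ 2)) +
      (X - 1) ^ 2 * ∏ j ∈ Finset.range i, ((X - 1) ^ 2 - C ((2 * ((j : ℤ) + 1)) ^ 2)) =
      C 2 * (oddProduct (i + 1) + C ((2 * (i : ℤ) + 1) * (2 * i + 2)) * oddProduct i) := by
    rw [pow_two (X + 1 : ℤ[X]), pow_two (X - 1 : ℤ[X]), mul_assoc, mul_assoc,
      ← pow_two (X + 1 : ℤ[X]), ← pow_two (X - 1 : ℤ[X]),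
      add_one_mul_prod_eq, sub_one_mul_prod_eq, oddProduct_succ]
    simp only [map_pow, map_mul, map_add, map_one, map_ofNat]
    ring
  rw [e, eulerFunctional_C_mul, map_add, eulerFunctional_C_mul] at h
  linarith

theorem eulerFunctional_oddProduct (i : ℕ) :
    eulerFunctional (oddProduct i) = (-1) ^ i * ((2 * i).factorial : ℤ) := by
  induction i with
  | zero => simpa [oddProduct, eulerNumber_zero] using eulerFunctional_X_pow 0
  | succ i ih =>
    rw [eulerFunctional_oddProduct_succ, ih, show 2 * (i + 1) = 2 * i + 1 + 1 by ring,
      Nat.factorial_succ, Nat.factorial_succ]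
    push_cast
    ring

-- This is `X² - 1 = (X² - (2i+1)²) + 4i(i+1)`.
open Polynomial in
theorem eulerFunctional_sub_one_pow_succ_mul_oddProduct (r i : ℕ) :
    eulerFunctional ((X ^ 2 - 1) ^ (r + 1) * oddProduct i) =
      eulerFunctional ((X ^ 2 - 1) ^ r * oddProduct (i + 1)) +
        4 * (i * (i + 1)) * eulerFunctional ((X ^ 2 - 1) ^ r * oddProduct i) := by
  rw [← eulerFunctional_C_mul, ← map_add, oddProduct_succ]
  congr 1
  simp only [map_pow, map_mul, map_add, map_one, map_ofNat]
  ring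

/-! ### Divisibility of the differences by powers of 2 -/

/-- The bound `s + 4` fails for small `s`. The alternative `3s - 8` (truncated at 0) meets it at `s
= 6` and has slope 3, matching the factor 8 in `4i(i+1)` used by the induction on `r`. -/
theorem two_pow_dvd_factorial_two_mul (s : ℕ) :
    2 ^ min (3 * s - 8) (s + 4) ∣ (2 * s).factorial := by
  rcases lt_or_ge s 6 with h | h
  · interval_cases s <;> decide
  · rw [min_eq_right (by omega)]
    induction s, h using Nat.le_induction with
    | base => decide
    | succ s hs ih =>
      rw [show 2 * (s + 1) = 2 * s + 1 + 1 by ring, Nat.factorial_succ, Nat.factorial_succ,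
        show s + 1 + 4 = s + 4 + 1 by ring, pow_succ, mul_comm]
      exact mul_dvd_mul ⟨s + 1, by ring⟩ (ih.mul_left _)

open Polynomial in
theorem two_pow_dvd_eulerFunctional (r i : ℕ) :
    2 ^ min (3 * (r + i) - 8) (r + i + 4) ∣
      eulerFunctional ((X ^ 2 - 1) ^ r * oddProduct i) := by
  induction r generalizing i with
  | zero =>
    rw [pow_zero, one_mul, eulerFunctional_oddProduct, zero_add]
    exact (by exact_mod_cast two_pow_dvd_factorial_two_mul i : (2 : ℤ) ^ _ ∣ _).mul_left _
  | succ r ih =>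
    rw [eulerFunctional_sub_one_pow_succ_mul_oddProduct]
    refine dvd_add ?_ ?_
    · have := ih (i + 1)
      rwa [show r + (i + 1) = r + 1 + i by ring] at this
    · have h8 : (2 : ℤ) ^ 3 ∣ 4 * (i * (i + 1)) := by
        obtain ⟨c, hc⟩ := (Int.even_mul_succ_self (i : ℤ)).two_dvd
        exact ⟨c, by rw [hc]; ring⟩
      refine (pow_dvd_pow _ ?_).trans ((pow_add (2 : ℤ) 3 _).symm ▸ mul_dvd_mul h8 (ih i))
      omega

/-! ### Newton expansion and its truncation -/

open Polynomial in
/-- The `r`-th forward difference at `0` of the sequence `n ↦ E_{2n}`. -/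
noncomputable def eulerDifference (r : ℕ) : ℤ := eulerFunctional ((X ^ 2 - 1) ^ r)

theorem two_pow_dvd_eulerDifference {r : ℕ} (hr : 6 ≤ r) : 2 ^ (r + 4) ∣ eulerDifference r := by
  have h := two_pow_dvd_eulerFunctional r 0
  rw [min_eq_right (by omega)] at h
  simpa [eulerDifference, oddProduct] using h

open Polynomial in
theorem eulerNumber_two_mul_eq_sum (n R : ℕ) (h : n < R) :
    eulerNumber (2 * n) = ∑ r ∈ Finset.range R, (n.choose r : ℤ) * eulerDifference r := by
  have e : (X : ℤ[X]) ^ (2 * n) =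
      ∑ r ∈ Finset.range (n + 1), C (n.choose r : ℤ) * (X ^ 2 - 1) ^ r := by
    rw [pow_mul, ← sub_add_cancel (X ^ 2 : ℤ[X]) 1, add_pow]
    simp [mul_comm]
  rw [← eulerFunctional_X_pow, e, map_sum]
  simp only [eulerFunctional_C_mul]
  refine Finset.sum_subset (Finset.range_subset_range.2 h) fun r _ hr => ?_
  rw [Finset.mem_range, not_lt] at hr
  rw [Nat.choose_eq_zero_of_lt (by omega)]
  simp

/-- From `j * C(N, j) = N * C(N-1, j-1)`, the binomial loses at most the 2-part `2^v` of `j`; since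
`2^v ≤ r < 2^(r-3)`, the surplus `2^(r-4)` pays for it. -/
theorem two_pow_dvd_mul_choose {e N j r : ℕ} (hN : 2 ^ e ∣ N) (hj : j ≠ 0) (hjr : j ≤ r)
    (hr : 6 ≤ r) : 2 ^ (e + 8) ∣ 2 ^ (r + 4) * N.choose j := by
  obtain ⟨v, d, hd, rfl⟩ := Nat.exists_eq_two_pow_mul_odd hj
  have hv : v ≤ r - 4 := by
    by_contra! hlt
    have h1 : r < 2 ^ (r - 3) := by
      clear hjr hlt
      induction r, hr using Nat.le_induction with
      | base => decide
      | succ r hr ih => rw [show r + 1 - 3 = r - 3 + 1 by omega, pow_succ]; omega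
    have h2 : 2 ^ (r - 3) ≤ 2 ^ v := Nat.pow_le_pow_right (by norm_num) (by omega)
    have h3 : 2 ^ v ≤ 2 ^ v * d := Nat.le_mul_of_pos_right _ hd.pos
    omega
  have h : 2 ^ e ∣ d * (2 ^ v * N.choose (2 ^ v * d)) := by
    obtain ⟨t, ht⟩ := Nat.exists_eq_succ_of_ne_zero hj
    rcases N with _ | N
    · rw [ht]; simp
    · refine hN.trans ⟨N.choose t, ?_⟩
      rw [← mul_assoc, mul_comm d, ht, mul_comm (t.succ), ← Nat.add_one_mul_choose_eq]
  have h' := (Nat.Coprime.pow_left e (Nat.coprime_two_left.2 hd)).dvd_of_dvd_mul_left h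
  rw [show r + 4 = (r - 4 - v) + v + 8 by omega, pow_add, pow_add, pow_add, mul_comm (2 ^ e)]
  rw [mul_right_comm, mul_assoc (2 ^ _) (2 ^ v), mul_comm _ (2 ^ 8)]
  exact mul_dvd_mul_left _ (h'.mul_left _)

theorem two_pow_dvd_mul_choose_add_sub_choose {e N r : ℕ} (n : ℕ) (hN : 2 ^ e ∣ N) (hr : 6 ≤ r) :
    (2 : ℤ) ^ (e + 8) ∣ 2 ^ (r + 4) * (((n + N).choose r : ℤ) - n.choose r) := by
  -- Vandermonde; the `j = 0` term cancels `C(n, r)`.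
  rw [add_comm n N, Nat.add_choose_eq, Finset.Nat.sum_antidiagonal_eq_sum_range_succ
    (fun i j => N.choose i * n.choose j), Finset.sum_range_succ']
  simp only [Nat.choose_zero_right, one_mul, Nat.sub_zero, Nat.cast_add, add_sub_cancel_right]
  rw [Nat.cast_sum, Finset.mul_sum]
  refine Finset.dvd_sum fun j hj => ?_
  rw [Finset.mem_range] at hj
  rw [Nat.cast_mul, ← mul_assoc]
  have := two_pow_dvd_mul_choose hN (j.succ_ne_zero) hj hr
  exact (by exact_mod_cast this : (2 : ℤ) ^ (e + 8) ∣ _).mul_right _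

theorem two_pow_dvd_eulerNumber_sub_sub_sum {e N : ℕ} (n : ℕ) (hN : 2 ^ e ∣ N) :
    (2 : ℤ) ^ (e + 8) ∣ eulerNumber (2 * (n + N)) - eulerNumber (2 * n) -
      ∑ r ∈ Finset.range 6, (((n + N).choose r : ℤ) - n.choose r) * eulerDifference r := by
  rw [eulerNumber_two_mul_eq_sum (n + N) (6 + (n + N)) (by omega),
    eulerNumber_two_mul_eq_sum n (6 + (n + N)) (by omega), ← Finset.sum_sub_distrib]
  simp only [← sub_mul]
  rw [Finset.sum_range_add, add_sub_cancel_left]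
  refine Finset.dvd_sum fun r _ => ?_
  obtain ⟨c, hc⟩ := two_pow_dvd_eulerDifference (r := 6 + r) (by omega)
  rw [hc, ← mul_assoc, mul_comm _ (2 ^ _)]
  exact (two_pow_dvd_mul_choose_add_sub_choose n hN (by omega)).mul_right _

/-! ### The explicit quintic and the case `m ≥ 3` -/

theorem eulerDifference_values : eulerDifference 0 = 1 ∧ eulerDifference 1 = -2 ∧
    eulerDifference 2 = 8 ∧ eulerDifference 3 = -80 ∧ eulerDifference 4 = 1664 ∧
    eulerDifference 5 = -58112 := by
  have h : ∀ r, eulerDifference r =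
      eulerFunctional ((Polynomial.X ^ 2 - 1) ^ r * oddProduct 0) := fun r => by
    simp [eulerDifference, oddProduct]
  have h0 : ∀ i, eulerFunctional ((Polynomial.X ^ 2 - 1) ^ 0 * oddProduct i) =
      (-1) ^ i * ((2 * i).factorial : ℤ) := fun i => by
    rw [pow_zero, one_mul, eulerFunctional_oddProduct]
  have h1 := fun i => eulerFunctional_sub_one_pow_succ_mul_oddProduct 0 i
  have h2 := fun i => eulerFunctional_sub_one_pow_succ_mul_oddProduct 1 i
  have h3 := fun i => eulerFunctional_sub_one_pow_succ_mul_oddProduct 2 i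
  have h4 := fun i => eulerFunctional_sub_one_pow_succ_mul_oddProduct 3 i
  have h5 := fun i => eulerFunctional_sub_one_pow_succ_mul_oddProduct 4 i
  simp only [Nat.reduceAdd] at h1 h2 h3 h4 h5
  simp only [h, h0, h1, h2, h3, h4, h5]
  norm_num [Nat.factorial]

/-- The factor 15 clears the denominators of `D_r / r!`; being odd, it can be cancelled modulo
powers of 2. -/
theorem fifteen_mul_sum_choose_mul_eulerDifference (x : ℕ) :
    15 * ∑ r ∈ Finset.range 6, (x.choose r : ℤ) * eulerDifference r =
      15 - 30 * x + 60 * (x * (x - 1)) - 200 * (x * (x - 1) * (x - 2)) +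
        1040 * (x * (x - 1) * (x - 2) * (x - 3)) -
        7264 * (x * (x - 1) * (x - 2) * (x - 3) * (x - 4)) := by
  have h : ∀ r : ℕ, ((r.factorial : ℕ) : ℤ) * x.choose r = (descPochhammer ℤ r).eval (x : ℤ) :=
    fun r => by
      rw [descPochhammer_eval_eq_descFactorial, Nat.descFactorial_eq_factorial_mul_choose]
      push_cast
      rfl
  have h2 := h 2
  have h3 := h 3
  have h4 := h 4
  have h5 := h 5
  simp only [descPochhammer_succ_eval, descPochhammer_zero, Polynomial.eval_one,
    Nat.factorial] at h2 h3 h4 h5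
  push_cast at h2 h3 h4 h5
  obtain ⟨e0, e1, e2, e3, e4, e5⟩ := eulerDifference_values
  simp only [Finset.sum_range_succ, Finset.sum_range_zero, e0, e1, e2, e3, e4, e5,
    Nat.choose_zero_right, Nat.choose_one_right]
  push_cast
  linear_combination 60 * h2 - 200 * h3 + 1040 * h4 - 7264 * h5

/-- With `N = 4M`, this polynomial is 15 times (quintic difference minus claimed value), divided by
`4M`. Modulo 256 only multiples of products of consecutive integers survive. -/
theorem dvd_difference_quotient (n M : ℤ) : (256 : ℤ) ∣
    -180736 + 1499520 * M - 4170880 * M ^ 2 + 4715520 * M ^ 3 - 1859584 * M ^ 4 + 749760 * n -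
    3127680 * n * M + 4715520 * n * M ^ 2 - 2324480 * n * M ^ 3 - 782880 * n ^ 2 + 1768320 *
    n ^ 2 * M - 1162240 * n ^ 2 * M ^ 2 + 294720 * n ^ 3 - 290560 * n ^ 3 * M - 36320 * n ^ 4 := by
  obtain ⟨a, ha⟩ := (Int.even_mul_succ_self M).two_dvd
  obtain ⟨u, hu⟩ := (Int.even_mul_succ_self n).two_dvd
  obtain ⟨v, hv⟩ := (Int.even_mul_pred_self u).two_dvd
  have h4 : (n - 1) * n * (n + 1) * (n + 2) = 8 * v := by
    linear_combination (n ^ 2 + n - 2 + 2 * u) * hu + 4 * hv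
  have e :
      -180736 + 1499520 * M - 4170880 * M ^ 2 + 4715520 * M ^ 3 - 1859584 * M ^ 4 + 749760 * n -
      3127680 * n * M + 4715520 * n * M ^ 2 - 2324480 * n * M ^ 3 - 782880 * n ^ 2 + 1768320 *
      n ^ 2 * M - 1162240 * n ^ 2 * M ^ 2 + 294720 * n ^ 3 - 290560 * n ^ 3 * M - 36320 * n ^ 4 =
      128 * (M * (M + 1)) + 128 * (M * (n * (n + 1))) + 32 * ((n - 1) * n * (n + 1) * (n + 2)) +
        256 * (-706 + 5857 * M - 16293 * M ^ 2 + 18420 * M ^ 3 - 7264 * M ^ 4 + 2929 * n - 12218 *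
          n * M + 18420 * n * M ^ 2 - 9080 * n * M ^ 3 - 3058 * n ^ 2 + 6907 * n ^ 2 * M - 4540 *
          n ^ 2 * M ^ 2 + 1151 * n ^ 3 - 1135 * n ^ 3 * M - 142 * n ^ 4) := by
    ring
  rw [e, ha, hu, h4]
  exact dvd_add ⟨a + M * u + v, by ring⟩ (dvd_mul_right _ _)

/-- The congruence for `E_{2n + 2N} - E_{2n}` when `N` is divisible by `4`. -/
theorem eulerNumber_add_sub_modEq (n k e : ℕ) (he : 2 ≤ e) :
    eulerNumber (2 * (n + 2 ^ e * k)) - eulerNumber (2 * n) ≡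
      2 * (2 ^ e * k) * (7 * (2 * (n : ℤ) + 1) ^ 2 - 18 + 2 * (2 ^ e * k) * (7 - 2 * n))
      [ZMOD 2 ^ (e + 8)] := by
  obtain ⟨f, rfl⟩ := Nat.exists_eq_add_of_le he
  have h := two_pow_dvd_eulerNumber_sub_sub_sum (e := 2 + f) n (Dvd.intro k rfl)
  have h1 := fifteen_mul_sum_choose_mul_eulerDifference (n + 2 ^ (2 + f) * k)
  have h2 := fifteen_mul_sum_choose_mul_eulerDifference n
  obtain ⟨c, hc⟩ := dvd_difference_quotient n (2 ^ f * k)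
  simp only [sub_mul, Finset.sum_sub_distrib] at h
  set S := ∑ r ∈ Finset.range 6, ((n + 2 ^ (2 + f) * k).choose r : ℤ) * eulerDifference r
  set T := ∑ r ∈ Finset.range 6, (n.choose r : ℤ) * eulerDifference r
  push_cast at h1
  have h15 : (2 : ℤ) ^ (2 + f + 8) ∣ 15 * (S - T - 2 * (2 ^ (2 + f) * k) *
      (7 * (2 * (n : ℤ) + 1) ^ 2 - 18 + 2 * (2 ^ (2 + f) * k) * (7 - 2 * n))) := by
    refine ⟨k * c, ?_⟩
    simp only [pow_add] at h1 ⊢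
    generalize (2 : ℤ) ^ f = d at *
    linear_combination h1 - h2 + 4 * d * k * hc
  have hcop : IsCoprime ((2 : ℤ) ^ (2 + f + 8)) 15 := IsCoprime.pow_left ⟨-7, 1, by norm_num⟩
  refine (Int.modEq_iff_dvd.2 ?_).symm
  rw [← sub_add_sub_cancel _ (S - T)]
  exact dvd_add h (hcop.dvd_of_dvd_mul_left h15)

/-! ### Euler numbers modulo 1024 and the cases `m = 1, 2` -/

theorem eulerNumber_eight_mul_add (s q : ℕ) : ∃ c : ℤ, eulerNumber (8 * q + 2 * s) =
    eulerNumber (2 * s) + 8 * q * (7 * (2 * (s : ℤ) + 1) ^ 2 - 18 + 8 * q * (7 - 2 * s)) +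
      1024 * c := by
  obtain ⟨c, hc⟩ := (eulerNumber_add_sub_modEq s q 2 le_rfl).symm.dvd
  refine ⟨c, ?_⟩
  rw [show 2 * (s + 2 ^ 2 * q) = 8 * q + 2 * s by ring] at hc
  linear_combination hc

theorem eulerNumber_values : eulerNumber 2 = -1 ∧ eulerNumber 4 = 5 ∧ eulerNumber 6 = -61 := by
  have h1 := sum_choose_mul_eulerNumber 1 (by norm_num)
  have h2 := sum_choose_mul_eulerNumber 2 (by norm_num)
  have h3 := sum_choose_mul_eulerNumber 3 (by norm_num)
  simp only [Finset.sum_range_succ, Finset.sum_range_zero, Nat.choose, eulerNumber_zero,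
    Nat.reduceMul, Nat.reduceAdd, Nat.cast_ofNat, mul_zero] at h1 h2 h3
  push_cast at h1 h2 h3
  refine ⟨?_, ?_, ?_⟩ <;> linarith


theorem exists_eulerNumber_two_mul (n : ℕ) : ∃ q c : ℤ,
    ((n : ℤ) = 4 * q ∧ (-1 : ℤ) ^ n = 1 ∧
      eulerNumber (2 * n) = 1 + 8 * q * (-11 + 56 * q) + 1024 * c) ∨
    ((n : ℤ) = 4 * q + 1 ∧ (-1 : ℤ) ^ n = -1 ∧
      eulerNumber (2 * n) = -1 + 8 * q * (45 + 40 * q) + 1024 * c) ∨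
    ((n : ℤ) = 4 * q + 2 ∧ (-1 : ℤ) ^ n = 1 ∧
      eulerNumber (2 * n) = 5 + 8 * q * (157 + 24 * q) + 1024 * c) ∨
    ((n : ℤ) = 4 * q + 3 ∧ (-1 : ℤ) ^ n = -1 ∧
      eulerNumber (2 * n) = -61 + 8 * q * (325 + 8 * q) + 1024 * c) := by
  obtain ⟨q, s, hs, rfl⟩ : ∃ q s, s < 4 ∧ n = 4 * q + s := ⟨n / 4, n % 4, by omega, by omega⟩
  obtain ⟨e2, e4, e6⟩ := eulerNumber_values
  obtain ⟨c, hc⟩ := eulerNumber_eight_mul_add s q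
  have h1 : (-1 : ℤ) ^ (4 * q + s) = (-1) ^ s := by
    rw [pow_add, pow_mul]
    norm_num
  refine ⟨q, c, ?_⟩
  rw [show 2 * (4 * q + s) = 8 * q + 2 * s by ring, hc, h1]
  interval_cases s
  · exact Or.inl ⟨by simp, by norm_num, by simp only [mul_zero, eulerNumber_zero]; push_cast; ring⟩
  · exact Or.inr (Or.inl ⟨by simp, by norm_num, by simp only [mul_one, e2]; push_cast; ring⟩)
  · exact Or.inr (Or.inr (Or.inl ⟨by simp, by norm_num,
      by simp only [Nat.reduceMul, e4]; push_cast; ring⟩))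
  · exact Or.inr (Or.inr (Or.inr ⟨by simp, by norm_num,
      by simp only [Nat.reduceMul, e6]; push_cast; ring⟩))

theorem eulerNumber_add_two_mul_modEq_of_even (n k : ℕ) (hk : Even k) :
    eulerNumber (2 * (n + k)) - eulerNumber (2 * n) ≡
      2 * (k : ℤ) * (-(2 * (n : ℤ) - 7) ^ 2 + 38 + 2 * (k : ℤ) * (3 * (2 * (n : ℤ)) - 1 + 2 * k))
      [ZMOD 2 ^ 8] := by
  obtain ⟨q, c, hn⟩ := exists_eulerNumber_two_mul n
  obtain ⟨p, d, hp⟩ := exists_eulerNumber_two_mul (n + k)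
  rw [← Int.even_coe_nat] at hk
  refine Int.modEq_iff_dvd.2 ?_
  have hkn : (k : ℤ) = (n + k : ℕ) - n := by push_cast; ring
  rcases hn with ⟨hn, -, h1⟩ | ⟨hn, -, h1⟩ | ⟨hn, -, h1⟩ | ⟨hn, -, h1⟩ <;>
  rcases hp with ⟨hp, -, h2⟩ | ⟨hp, -, h2⟩ | ⟨hp, -, h2⟩ | ⟨hp, -, h2⟩ <;>
  rw [hp, hn] at hkn <;> rw [hkn] at hk ⊢ <;>
  first
  | (exfalso; revert hk; rw [Int.even_iff]; omega)
  -- In terms of `p` and `q`, the difference has every coefficient divisible by 256, so `omega` may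
  -- treat the monomials as atoms.
  | (rw [h1, h2, hn]; clear * -; ring_nf; omega)

theorem eulerNumber_add_two_mul_modEq_of_not_even (n k : ℕ) (hk : ¬ Even k) :
    eulerNumber (2 * (n + k)) - eulerNumber (2 * n) ≡
      2 * (k : ℤ) * (-(2 * (n : ℤ) + 1) ^ 2 + 6 + 2 * (k : ℤ) * (3 * (2 * (n : ℤ)) - 1 + 2 * k))
        - 16 * (2 * (n : ℤ) + (-1) ^ n) [ZMOD 2 ^ 8] := by
  obtain ⟨q, c, hn⟩ := exists_eulerNumber_two_mul n
  obtain ⟨p, d, hp⟩ := exists_eulerNumber_two_mul (n + k)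
  rw [← Int.even_coe_nat] at hk
  refine Int.modEq_iff_dvd.2 ?_
  have hkn : (k : ℤ) = (n + k : ℕ) - n := by push_cast; ring
  rcases hn with ⟨hn, h0, h1⟩ | ⟨hn, h0, h1⟩ | ⟨hn, h0, h1⟩ | ⟨hn, h0, h1⟩ <;>
  rcases hp with ⟨hp, -, h2⟩ | ⟨hp, -, h2⟩ | ⟨hp, -, h2⟩ | ⟨hp, -, h2⟩ <;>
  rw [hp, hn] at hkn <;> rw [hkn] at hk ⊢ <;>
  first
  | (exfalso; revert hk; rw [Int.even_iff]; omega)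
  | (rw [h0, h1, h2, hn]; clear * -; ring_nf; omega)

theorem eulerNumber_add_four_mul_modEq (n k : ℕ) :
    eulerNumber (2 * (n + 2 * k)) - eulerNumber (2 * n) ≡
      4 * (k : ℤ) * (7 * (2 * (n : ℤ) + 1) ^ 2 - 18
        + 12 * (k : ℤ) * (2 * (n : ℤ) + 1 + 4 * ((-1) ^ n - (k : ℤ)))) [ZMOD 2 ^ 9] := by
  obtain ⟨q, c, hn⟩ := exists_eulerNumber_two_mul n
  obtain ⟨p, d, hp⟩ := exists_eulerNumber_two_mul (n + 2 * k)
  refine Int.modEq_iff_dvd.2 ?_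
  push_cast at hp
  rcases hn with ⟨hn, h0, h1⟩ | ⟨hn, h0, h1⟩ | ⟨hn, h0, h1⟩ | ⟨hn, h0, h1⟩ <;>
  rcases hp with ⟨hp, -, h2⟩ | ⟨hp, -, h2⟩ | ⟨hp, -, h2⟩ | ⟨hp, -, h2⟩ <;>
  first
  | (exfalso; omega)
  -- Here `2j` is the difference of the residues mod 4 of `n + 2k` and `n`, hence 0 or ±2.
  | (obtain ⟨j, hj⟩ : ∃ j : ℤ, (k : ℤ) = 2 * (p - q) + j ∧ (j = 0 ∨ j = 1 ∨ j = -1) :=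
      ⟨k - 2 * (p - q), by ring, by omega⟩
     obtain ⟨hj, rfl | rfl | rfl⟩ := hj <;>
     first
     | (exfalso; omega)
     | (rw [h0, h1, h2, hn, hj]; clear * -; ring_nf; omega))

theorem theorem2p1 (b k m : ℕ) (hb : Even b) (hk : 1 ≤ k) (hm : 1 ≤ m) :
    (m = 1 → Even k →
      eulerNumber (2 ^ m * k + b) - eulerNumber b ≡
        2 * (k : ℤ) * (-((b : ℤ) - 7) ^ 2 + 38 + 2 * (k : ℤ) * (3 * (b : ℤ) - 1 + 2 * (k : ℤ)))
        [ZMOD 2 ^ (m + 7)]) ∧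
    (m = 1 → ¬ Even k →
      eulerNumber (2 ^ m * k + b) - eulerNumber b ≡
        2 * (k : ℤ) * (-((b : ℤ) + 1) ^ 2 + 6 + 2 * (k : ℤ) * (3 * (b : ℤ) - 1 + 2 * (k : ℤ)))
          - 16 * ((b : ℤ) + (-1) ^ (b / 2))
        [ZMOD 2 ^ (m + 7)]) ∧
    (m = 2 →
      eulerNumber (2 ^ m * k + b) - eulerNumber b ≡
        4 * (k : ℤ) * (7 * ((b : ℤ) + 1) ^ 2 - 18
          + 12 * (k : ℤ) * ((b : ℤ) + 1 + 4 * ((-1) ^ (b / 2) - (k : ℤ))))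
        [ZMOD 2 ^ (m + 7)]) ∧
    (3 ≤ m →
      eulerNumber (2 ^ m * k + b) - eulerNumber b ≡
        2 ^ m * (k : ℤ) * (7 * ((b : ℤ) + 1) ^ 2 - 18 + 2 ^ m * (k : ℤ) * (7 - (b : ℤ)))
        [ZMOD 2 ^ (m + 7)]) := by
  obtain ⟨n, rfl⟩ := hb.two_dvd
  rw [Nat.mul_div_cancel_left n two_pos]
  push_cast
  refine ⟨?_, ?_, ?_, fun h => ?_⟩
  · rintro rfl h
    rw [show 2 ^ 1 * k + 2 * n = 2 * (n + k) by ring]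
    exact eulerNumber_add_two_mul_modEq_of_even n k h
  · rintro rfl h
    rw [show 2 ^ 1 * k + 2 * n = 2 * (n + k) by ring]
    exact eulerNumber_add_two_mul_modEq_of_not_even n k h
  · rintro rfl
    rw [show 2 ^ 2 * k + 2 * n = 2 * (n + 2 * k) by ring]
    exact eulerNumber_add_four_mul_modEq n k
  -- The shift `2^m k` in the index is `2N` with `N = 2^(m-1) k`, so `e = m - 1` and `e + 8 = m +
  -- 7`.
  · obtain ⟨e, rfl⟩ := Nat.exists_eq_add_of_le' (show 1 ≤ m by omega)
    have := eulerNumber_add_sub_modEq n k e (by omega)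
    rw [show 2 * (n + 2 ^ e * k) = 2 ^ (e + 1) * k + 2 * n by ring] at this
    convert this using 1
    ring
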